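/- Let $K\ge 1$ users share a block-fading TDMA uplink. Let the fading state $\mathbf h=(h_1,\dots,h_K)$ be a random vector with $h_k>0$ almost surely and finite ergodic capacities $E[\log(1+h_k)]<\infty$ for all $k$ ($\log$ is to base $2$, $[x]_+=\max(x,0)$). A policy is a pair of measurable functions $\mathbf r(\cdot),\boldsymbol\tau(\cdot)$ of the state, with $r_k(\mathbf h)\ge 0$, $\tau_k(\mathbf h)\ge 0$ and $\sum_k\tau_k(\mathbf h)=1$ for every $\mathbf h>\mathbf 0$. Let $\bar R_k>0$ and $\mu_k>0$ for $k=1,\dots,K$, and consider the problem $$\min_{\mathbf r(\cdot),\boldsymbol\tau(\cdot)} E_{\mathbf h}\Big[\sum_{k=1}^K \mu_k\frac{\tau_k(\mathbf h)}{h_k}\big(2^{r_k(\mathbf h)}-1\big)\Big]\quad\text{subject to}\quad E_{\mathbf h}[\tau_k(\mathbf h)r_k(\mathbf h)]\ge\bar R_k,\quad k=1,\dots,K, \tag{1}$$ over all policies. Then there exists $\boldsymbol\lambda^*=(\lambda^*_1,\dots,\lambda^*_K)$ with all $\lambda_k^*>0$ such that, with $$f_k(x)=\frac{\mu_k}{h_k}(2^x-1)-\lambda_k^*x,\qquad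 r_{k,\min}(\mathbf h)=\Big[\log\lambda_k^*-\log\frac{\mu_k\ln 2}{h_k}\Big]_+,$$ the following hold. (a) For every $\mathbf h>\mathbf 0$ and every $k$, $f_k$ is convex and attains its minimum over $[0,\infty)$ at $r_{k,\min}(\mathbf h)$. (b) For every $\mathbf h>\mathbf 0$, rates $\rho_k\ge0$ and time fractions $t_k\ge 0$ with $\sum_k t_k=1$ minimize $\sum_k t_kf_k(\rho_k)$ among all such rates and fractions if and only if every user $k$ with $t_k>0$ minimizes $f_j(r_{j,\min}(\mathbf h))$ over $j=1,\dots,K$ and has $\rho_k=r_{k,\min}(\mathbf h)$. (c) Problem (1) has optimal policies $\mathbf r^*(\cdot),\boldsymbol\tau^*(\cdot)$ such that $E_{\mathbf h}[\tau_k^*(\mathbf h)r_k^*(\mathbf h)]=\bar R_k$ for all $k$ and such that, for every $\mathbf h>\mathbf 0$, $(\mathbf r^*(\mathbf h),\boldsymbol\tau^*(\mathbf h))$ solves the minimization in (b) and has the greedy water-filling form: every user $k$ that minimizes $f_j(r_{j,\min}(\mathbf h))$ over $j$ has $r_k^*(\mathbf h)=r_{k,\min}(\mathbf h)$, these users share the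 whole block, and all other users have $r_k^*(\mathbf h)=\tau_k^*(\mathbf h)=0$. In particular, if there is a single minimizing user $i$, then $\tau_i^*(\mathbf h)=1$. (d) If the law of $\mathbf h$ has a density, the time division among several minimizing users in (c) is arbitrary: with this $\boldsymbol\lambda^*$, all measurable $\mathbf r(\cdot),\boldsymbol\tau(\cdot)$ of the greedy water-filling form are optimal for (1) and satisfy $E_{\mathbf h}[\tau_k(\mathbf h)r_k(\mathbf h)]=\bar R_k$ for all $k$. -/

import Mathlib

open MeasureTheory

namespace TDMA

/-- A (joint) fading state: all channel gains are positive. -/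
def IsFadingState {K : ℕ} (h : Fin K → ℝ) : Prop := ∀ k, 0 < h k

/-- An allocation inside one time block: the users transmit at nonnegative rates `ρ k` during
nonnegative time fractions `t k` that add up to one. -/
structure IsAllocation {K : ℕ} (ρ t : Fin K → ℝ) : Prop where
  rate_nonneg : ∀ k, 0 ≤ ρ k
  time_nonneg : ∀ k, 0 ≤ t k
  time_sum : ∑ k, t k = 1

/-- The average rate `E_h[τ_k(h) r_k(h)]` of user `k` (an expectation of a nonnegative quantity,
with values in `[0, ∞]`), where `P` is the law of the fading state. -/
noncomputable def avgRate {K : ℕ} (P : Measure (Fin K → ℝ)) (r τ : (Fin K → ℝ) → Fin K → ℝ)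
    (k : Fin K) : ENNReal :=
  ∫⁻ h, ENNReal.ofReal (τ h k * r h k) ∂P

/-- The weighted average power `E_h[∑ k, μ_k (τ_k(h) / h_k) (2 ^ r_k(h) - 1)]` (an expectation of
a nonnegative quantity, with values in `[0, ∞]`). -/
noncomputable def avgPower {K : ℕ} (P : Measure (Fin K → ℝ)) (μ : Fin K → ℝ)
    (r τ : (Fin K → ℝ) → Fin K → ℝ) : ENNReal :=
  ∫⁻ h, ENNReal.ofReal (∑ k, μ k * (τ h k / h k) * ((2 : ℝ) ^ (r h k) - 1)) ∂P

/-- Rate and time allocation policies: measurable functions of the fading state that give an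
allocation in each state. -/
structure IsPolicy {K : ℕ} (r τ : (Fin K → ℝ) → Fin K → ℝ) : Prop where
  measurable_rate : Measurable r
  measurable_time : Measurable τ
  allocation : ∀ h, IsFadingState h → IsAllocation (r h) (τ h)

/-- Feasible policies: those meeting the individual average-rate constraints
`E_h[τ_k(h) r_k(h)] ≥ Rbar_k`. -/
structure IsFeasible {K : ℕ} (P : Measure (Fin K → ℝ)) (Rbar : Fin K → ℝ)
    (r τ : (Fin K → ℝ) → Fin K → ℝ) : Prop where
  policy : IsPolicy r τ
  rate_constraint : ∀ k, ENNReal.ofReal (Rbar k) ≤ avgRate P r τ k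

/-- Optimal policies: feasible ones of least weighted average power. -/
structure IsOptimal {K : ℕ} (P : Measure (Fin K → ℝ)) (Rbar μ : Fin K → ℝ)
    (r τ : (Fin K → ℝ) → Fin K → ℝ) : Prop where
  feasible : IsFeasible P Rbar r τ
  minimal : ∀ r' τ', IsFeasible P Rbar r' τ' → avgPower P μ r τ ≤ avgPower P μ r' τ'

/-- The net cost `f(x) = (m / g) (2 ^ x - 1) - l x` of transmitting at rate `x`, for a user with
power price `m`, multiplier `l` and channel gain `g`. -/
noncomputable def netCost (m l g x : ℝ) : ℝ := m / g * ((2 : ℝ) ^ x - 1) - l * x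

/-- The water-filling rate `[log l - log (ln 2 * m / g)]_+`, with logarithms to base 2. -/
noncomputable def rateMin (m l g : ℝ) : ℝ :=
  max (Real.logb 2 l - Real.logb 2 (Real.log 2 * m / g)) 0

/-- User `i` minimizes `f_k(r_{k,min})` among all users `k`. -/
def IsBest {K : ℕ} (μ lam h : Fin K → ℝ) (i : Fin K) : Prop :=
  ∀ k, netCost (μ i) (lam i) (h i) (rateMin (μ i) (lam i) (h i)) ≤
    netCost (μ k) (lam k) (h k) (rateMin (μ k) (lam k) (h k))

/-- `(ρ, t)` solves the problem of a single fading state `h`: it minimizes `∑ k, t_k f_k(ρ_k)`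
over all allocations. -/
structure SolvesState {K : ℕ} (μ lam h ρ t : Fin K → ℝ) : Prop where
  allocation : IsAllocation ρ t
  minimal : ∀ ρ' t', IsAllocation ρ' t' →
    ∑ k, t k * netCost (μ k) (lam k) (h k) (ρ k) ≤
      ∑ k, t' k * netCost (μ k) (lam k) (h k) (ρ' k)

/-- The greedy water-filling allocation in the fading state `h`: best users have their
water-filling rates and share the block (in an arbitrary way), all others have zero rate and
time. -/
structure IsGreedy {K : ℕ} (μ lam h ρ t : Fin K → ℝ) : Prop where
  time_nonneg : ∀ k, 0 ≤ t k
  time_sum : ∑ k, t k = 1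
  best : ∀ k, IsBest μ lam h k → ρ k = rateMin (μ k) (lam k) (h k)
  not_best : ∀ k, ¬ IsBest μ lam h k → ρ k = 0 ∧ t k = 0

end TDMA

namespace TDMA

/-- The water-filling rate, extended by zero to nonpositive multipliers. -/
noncomputable def waterRate (m l g : ℝ) : ℝ :=
  Real.logb 2 (max (l * g / (Real.log 2 * m)) 1)

/-- The largest net gain `l x - m / g (2 ^ x - 1)` over nonnegative rates `x`. -/
noncomputable def surplus (m l g : ℝ) : ℝ := -netCost m l g (waterRate m l g)

theorem waterRate_nonneg (m l g : ℝ) : 0 ≤ waterRate m l g :=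
  Real.logb_nonneg (by norm_num) (le_max_right _ _)

theorem two_rpow_waterRate (m l g : ℝ) :
    (2 : ℝ) ^ waterRate m l g = max (l * g / (Real.log 2 * m)) 1 :=
  Real.rpow_logb (by norm_num) (by norm_num) (lt_max_of_lt_right one_pos)

theorem log_two_pos : 0 < Real.log 2 := Real.log_pos (by norm_num)

theorem waterRate_eq_rateMin {m l g : ℝ} (hm : 0 < m) (hl : 0 < l) (hg : 0 < g) :
    waterRate m l g = rateMin m l g := by
  have h2 := log_two_pos
  have hs : 0 < l * g / (Real.log 2 * m) := by positivity
  have e : Real.logb 2 l - Real.logb 2 (Real.log 2 * m / g) =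
      Real.logb 2 (l * g / (Real.log 2 * m)) := by
    rw [← Real.logb_div hl.ne' (by positivity)]
    congr 1
    field_simp
  rw [rateMin, e, waterRate]
  rcases le_total (l * g / (Real.log 2 * m)) 1 with h | h
  · rw [max_eq_right h, Real.logb_one, max_eq_right (Real.logb_nonpos (by norm_num) hs.le h)]
  · rw [max_eq_left h, max_eq_left (Real.logb_nonneg (by norm_num) h)]

theorem waterRate_of_nonpos {m l g : ℝ} (hm : 0 < m) (hl : l ≤ 0) (hg : 0 < g) :
    waterRate m l g = 0 := by
  have h2 := log_two_pos
  rw [waterRate, max_eq_right, Real.logb_one]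
  exact (div_nonpos_of_nonpos_of_nonneg (mul_nonpos_of_nonpos_of_nonneg hl hg.le)
    (by positivity)).trans zero_le_one

theorem waterRate_mono {m g : ℝ} (hm : 0 < m) (hg : 0 < g) :
    Monotone fun l => waterRate m l g := by
  intro l l' h
  have h2 := log_two_pos
  refine Real.logb_le_logb_of_le (by norm_num) (lt_max_of_lt_right one_pos) ?_
  exact max_le_max_right _ (by gcongr)

theorem continuous_waterRate (m g : ℝ) : Continuous fun l => waterRate m l g := by
  unfold waterRate Real.logb
  refine Continuous.div_const (Continuous.log (by fun_prop) fun x => ?_) _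
  exact (lt_max_of_lt_right one_pos).ne'

theorem measurable_waterRate (m l : ℝ) : Measurable fun g => waterRate m l g := by
  unfold waterRate Real.logb
  fun_prop

theorem netCost_waterRate_lt {m l g x : ℝ} (hm : 0 < m) (hg : 0 < g) (hx : 0 ≤ x)
    (hne : x ≠ waterRate m l g) : netCost m l g (waterRate m l g) < netCost m l g x := by
  have h2 := log_two_pos
  set p := waterRate m l g with hp
  set s := l * g / (Real.log 2 * m) with hs
  have hpow : (2 : ℝ) ^ p = max s 1 := two_rpow_waterRate m l g
  have hl : l = m / g * Real.log 2 * s := by rw [hs]; field_simp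
  have hx2 : (2 : ℝ) ^ x = max s 1 * Real.exp (Real.log 2 * (x - p)) := by
    rw [← hpow, Real.rpow_def_of_pos two_pos, Real.rpow_def_of_pos two_pos, ← Real.exp_add]
    congr 1; ring
  have hexp : Real.log 2 * (x - p) + 1 < Real.exp (Real.log 2 * (x - p)) :=
    Real.add_one_lt_exp (mul_ne_zero h2.ne' (sub_ne_zero.2 hne))
  have hS : 0 < max s 1 := lt_max_of_lt_right one_pos
  have hslope : 0 ≤ (max s 1 - s) * (x - p) := by
    rcases le_total s 1 with h | h
    · have : p = 0 := by rw [hp, waterRate, ← hs, max_eq_right h, Real.logb_one]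
      rw [this, max_eq_right h, sub_zero]
      exact mul_nonneg (sub_nonneg.2 h) hx
    · rw [max_eq_left h]; simp
  have hmg : 0 < m / g := by positivity
  have k1 := mul_lt_mul_of_pos_left (mul_lt_mul_of_pos_left hexp hS) hmg
  have k2 := mul_nonneg (mul_nonneg hmg.le h2.le) hslope
  unfold netCost
  rw [hpow, hx2]
  have e : l * (x - p) = m / g * Real.log 2 * s * (x - p) := by rw [← hl]
  nlinarith [k1, k2, e]

theorem netCost_waterRate_le {m l g x : ℝ} (hm : 0 < m) (hg : 0 < g) (hx : 0 ≤ x) :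
    netCost m l g (waterRate m l g) ≤ netCost m l g x := by
  by_cases h : x = waterRate m l g
  · rw [h]
  · exact (netCost_waterRate_lt hm hg hx h).le

theorem netCost_zero (m l g : ℝ) : netCost m l g 0 = 0 := by simp [netCost]

theorem surplus_nonneg {m g : ℝ} (l : ℝ) (hm : 0 < m) (hg : 0 < g) : 0 ≤ surplus m l g := by
  have := netCost_waterRate_le (l := l) hm hg le_rfl
  rw [netCost_zero] at this
  exact neg_nonneg.2 this

theorem surplus_pos {m l g : ℝ} (hm : 0 < m) (hg : 0 < g) (h : 0 < waterRate m l g) :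
    0 < surplus m l g := by
  have := netCost_waterRate_lt hm hg le_rfl h.ne
  rw [netCost_zero] at this
  exact neg_pos.2 this

theorem le_surplus {m g x : ℝ} (l : ℝ) (hm : 0 < m) (hg : 0 < g) (hx : 0 ≤ x) :
    l * x - m / g * ((2 : ℝ) ^ x - 1) ≤ surplus m l g := by
  have := netCost_waterRate_le (l := l) hm hg hx
  rw [surplus]
  simp only [netCost] at this ⊢
  linarith

theorem surplus_subgradient {m g : ℝ} (l l' : ℝ) (hm : 0 < m) (hg : 0 < g) :
    surplus m l g + (l' - l) * waterRate m l g ≤ surplus m l' g := by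
  have := le_surplus l' hm hg (waterRate_nonneg m l g)
  rw [surplus, netCost]
  linarith

theorem surplus_mono {m g : ℝ} (hm : 0 < m) (hg : 0 < g) : Monotone fun l => surplus m l g := by
  intro l l' h
  have := surplus_subgradient l l' hm hg
  nlinarith [waterRate_nonneg m l g]

theorem surplus_le {m l g : ℝ} (hm : 0 < m) (hg : 0 < g) :
    surplus m l g ≤ l * waterRate m l g := by
  have : (1 : ℝ) ≤ 2 ^ waterRate m l g := by rw [two_rpow_waterRate]; exact le_max_right _ _
  have h : 0 ≤ m / g * ((2 : ℝ) ^ waterRate m l g - 1) :=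
    mul_nonneg (by positivity) (by linarith)
  rw [surplus, netCost]
  linarith

theorem continuous_surplus (m g : ℝ) : Continuous fun l => surplus m l g := by
  unfold surplus netCost
  simp only [two_rpow_waterRate]
  have := continuous_waterRate m g
  fun_prop

theorem measurable_surplus (m l : ℝ) : Measurable fun g => surplus m l g := by
  unfold surplus netCost
  simp only [two_rpow_waterRate]
  have := measurable_waterRate m l
  fun_prop

theorem waterRate_le {m g : ℝ} (l : ℝ) (hm : 0 < m) (hg : 0 < g) :
    waterRate m l g ≤
      (Real.log (1 + |l| / (Real.log 2 * m)) + Real.log (1 + g)) / Real.log 2 := by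
  have h2 := log_two_pos
  have hc : 0 ≤ |l| / (Real.log 2 * m) := by positivity
  rw [waterRate, Real.logb, ← Real.log_mul (by positivity) (by positivity)]
  refine div_le_div_of_nonneg_right (Real.log_le_log (lt_max_of_lt_right one_pos) ?_) h2.le
  refine max_le ?_ (by nlinarith)
  have : l * g / (Real.log 2 * m) ≤ |l| / (Real.log 2 * m) * g := by
    rw [div_mul_eq_mul_div]
    gcongr
    exact le_abs_self l
  nlinarith

theorem surplus_strictMono {m l g g' : ℝ} (hm : 0 < m) (hg : 0 < g) (hgg : g < g')
    (h : 0 < surplus m l g) : surplus m l g < surplus m l g' := by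
  have hr : 0 < waterRate m l g := by
    refine (waterRate_nonneg m l g).lt_of_ne fun h0 => ?_
    rw [surplus, ← h0, netCost_zero] at h
    simp at h
  have h1 := le_surplus l hm (hg.trans hgg) hr.le
  refine lt_of_lt_of_le ?_ h1
  have : (1 : ℝ) < 2 ^ waterRate m l g := Real.one_lt_rpow (by norm_num) hr
  have : m / g' * ((2 : ℝ) ^ waterRate m l g - 1) < m / g * ((2 : ℝ) ^ waterRate m l g - 1) :=
    mul_lt_mul_of_pos_right (div_lt_div_of_pos_left hm hg hgg) (by linarith)
  rw [surplus, netCost]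
  linarith

theorem integrable_waterRate {Ω : Type*} [MeasurableSpace Ω] {P : Measure Ω} [IsFiniteMeasure P]
    {m : ℝ} (hm : 0 < m) {g : Ω → ℝ} (hg : ∀ ω, 0 < g ω) (hgm : Measurable g)
    (hint : Integrable (fun ω => Real.log (1 + g ω)) P) (l : ℝ) :
    Integrable (fun ω => waterRate m l (g ω)) P := by
  refine Integrable.mono' (((integrable_const (Real.log (1 + |l| / (Real.log 2 * m)))).add
    hint).div_const (Real.log 2)) ((measurable_waterRate m l).comp hgm).aestronglyMeasurable ?_
  refine Filter.Eventually.of_forall fun ω => ?_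
  rw [Real.norm_of_nonneg (waterRate_nonneg _ _ _)]
  exact waterRate_le l hm (hg ω)

theorem convexOn_netCost {m l g : ℝ} (hm : 0 < m) (hg : 0 < g) :
    ConvexOn ℝ Set.univ (netCost m l g) := by
  have h1 : ConvexOn ℝ Set.univ fun x : ℝ => (2 : ℝ) ^ x := by
    have := convexOn_exp.comp_linearMap (LinearMap.mulLeft ℝ (Real.log 2))
    simpa [Function.comp_def, Real.rpow_def_of_pos two_pos] using this
  have h2 := ((h1.add_const (-1)).smul (c := m / g) (by positivity)).add
    ((LinearMap.mulLeft ℝ (-l)).convexOn convex_univ)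
  refine h2.congr fun x _ => ?_
  simp [netCost]
  ring

end TDMA

namespace TDMA
open Filter Topology

theorem nonempty_iInter_of_antitone_convex {H : Type*} [NormedAddCommGroup H]
    [InnerProductSpace ℝ H] [CompleteSpace H] {T : ℕ → Set H} (hanti : Antitone T)
    (hne : ∀ n, (T n).Nonempty) (hcl : ∀ n, IsClosed (T n)) (hconv : ∀ n, Convex ℝ (T n))
    (hb : Bornology.IsBounded (T 0)) : (⋂ n, T n).Nonempty := by
  choose v hv hmin using fun n =>
    exists_norm_eq_iInf_of_complete_convex (hne n) (hcl n).isComplete (hconv n) 0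
  have hvar : ∀ n m, n ≤ m → ‖v m - v n‖ ^ 2 ≤ ‖v m‖ ^ 2 - ‖v n‖ ^ 2 := by
    intro n m hnm
    have h := (norm_eq_iInf_iff_real_inner_le_zero (hconv n) (hv n)).1 (hmin n) (v m)
      (hanti hnm (hv m))
    rw [zero_sub, inner_neg_left] at h
    have e := norm_add_sq_real (v n) (v m - v n)
    rw [add_sub_cancel] at e
    linarith
  have hmono : Monotone fun n => ‖v n‖ ^ 2 := fun n m hnm => by
    have := hvar n m hnm
    have := sq_nonneg ‖v m - v n‖
    simp only
    linarith
  obtain ⟨C, hC⟩ := hb.exists_norm_le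
  have hbdd : BddAbove (Set.range fun n => ‖v n‖ ^ 2) := by
    refine ⟨C ^ 2, ?_⟩
    rintro _ ⟨n, rfl⟩
    exact pow_le_pow_left₀ (norm_nonneg _) (hC _ (hanti (Nat.zero_le n) (hv n))) 2
  have hcau := (tendsto_atTop_ciSup hmono hbdd).cauchySeq
  have hvc : CauchySeq v := by
    rw [Metric.cauchySeq_iff'] at hcau ⊢
    intro ε hε
    obtain ⟨N, hN⟩ := hcau (ε ^ 2) (by positivity)
    refine ⟨N, fun n hn => ?_⟩
    have h1 := hN n hn
    rw [Real.dist_eq] at h1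
    have h2 := (hvar N n hn).trans (le_abs_self _)
    rw [dist_eq_norm]
    exact lt_of_pow_lt_pow_left₀ 2 hε.le (h2.trans_lt h1)
  obtain ⟨x, hx⟩ := cauchySeq_tendsto_of_complete hvc
  refine ⟨x, Set.mem_iInter.2 fun n => (hcl n).mem_of_tendsto hx ?_⟩
  filter_upwards [eventually_ge_atTop n] with m hm using hanti hm (hv m)

theorem isClosed_image_of_convex_bounded {H F : Type*} [NormedAddCommGroup H]
    [InnerProductSpace ℝ H] [CompleteSpace H] [NormedAddCommGroup F] [NormedSpace ℝ F]
    {T : Set H} (hcl : IsClosed T) (hconv : Convex ℝ T) (hb : Bornology.IsBounded T)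
    (L : H →L[ℝ] F) : IsClosed (L '' T) := by
  refine isClosed_of_closure_subset fun y hy => ?_
  have hball : ∀ n : ℕ, (T ∩ L ⁻¹' Metric.closedBall y (1 / ((n : ℝ) + 1))).Nonempty := by
    intro n
    obtain ⟨_, ⟨x, hx, rfl⟩, hd⟩ := Metric.mem_closure_iff.1 hy _ (Nat.one_div_pos_of_nat (n := n))
    exact ⟨x, hx, by rw [Set.mem_preimage, Metric.mem_closedBall, dist_comm]; exact hd.le⟩
  obtain ⟨x, hx⟩ := nonempty_iInter_of_antitone_convex
    (T := fun n : ℕ => T ∩ L ⁻¹' Metric.closedBall y (1 / ((n : ℝ) + 1)))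
    (fun n m hnm => Set.inter_subset_inter_right _ (Set.preimage_mono
      (Metric.closedBall_subset_closedBall (Nat.one_div_le_one_div hnm)))) hball
    (fun n => hcl.inter (Metric.isClosed_closedBall.preimage L.continuous))
    (fun n => hconv.inter ((convex_closedBall y _).is_linear_preimage L.isLinear))
    (hb.subset Set.inter_subset_left)
  rw [Set.mem_iInter] at hx
  refine ⟨x, (hx 0).1, dist_le_zero.1 (ge_of_tendsto' tendsto_one_div_add_atTop_nhds_zero_nat
    fun n => (hx n).2)⟩

variable {ι Ω : Type*} [Fintype ι]

/-- Simplex of size `s` on the face of the indices active at `ω`. -/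
def activeSimplex (B : ι → Set Ω) (s : Ω → ℝ) (ω : Ω) : Set (EuclideanSpace ℝ ι) :=
  {x | (∀ k, 0 ≤ x k) ∧ ∑ k, x k = s ω ∧ ∀ k, ω ∉ B k → x k = 0}

theorem isClosed_activeSimplex (B : ι → Set Ω) (s : Ω → ℝ) (ω : Ω) :
    IsClosed (activeSimplex B s ω) := by
  have e : activeSimplex B s ω = (⋂ k, {x : EuclideanSpace ℝ ι | 0 ≤ x k}) ∩
      ({x : EuclideanSpace ℝ ι | ∑ k, x k = s ω} ∩
        ⋂ k, ⋂ _ : ω ∉ B k, {x : EuclideanSpace ℝ ι | x k = 0}) := by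
    ext x; simp [activeSimplex]
  rw [e]
  refine (isClosed_iInter fun k => ?_).inter (IsClosed.inter ?_
    (isClosed_iInter fun k => isClosed_iInter fun _ => ?_))
  · exact isClosed_le (by fun_prop) (by fun_prop)
  · exact isClosed_eq (by fun_prop) (by fun_prop)
  · exact isClosed_eq (by fun_prop) (by fun_prop)

theorem convex_activeSimplex (B : ι → Set Ω) (s : Ω → ℝ) (ω : Ω) :
    Convex ℝ (activeSimplex B s ω) := by
  rintro x ⟨hx0, hx1, hx2⟩ y ⟨hy0, hy1, hy2⟩ a b ha hb hab
  refine ⟨fun k => ?_, ?_, fun k h => ?_⟩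
  · have := hx0 k
    have := hy0 k
    simp only [PiLp.add_apply, PiLp.smul_apply, smul_eq_mul]
    positivity
  · simp only [PiLp.add_apply, PiLp.smul_apply, smul_eq_mul]
    rw [Finset.sum_add_distrib, ← Finset.mul_sum, ← Finset.mul_sum, hx1, hy1, ← add_mul, hab,
      one_mul]
  · simp [hx2 k h, hy2 k h]

theorem norm_le_of_mem_activeSimplex {B : ι → Set Ω} {s : Ω → ℝ} {ω : Ω}
    {x : EuclideanSpace ℝ ι} (hx : x ∈ activeSimplex B s ω) : ‖x‖ ≤ s ω := by
  rw [← hx.2.1, EuclideanSpace.norm_eq]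
  refine Real.sqrt_le_iff.2 ⟨Finset.sum_nonneg fun k _ => hx.1 k, ?_⟩
  simp only [Real.norm_eq_abs, sq_abs]
  exact Finset.sum_sq_le_sq_sum_of_nonneg fun k _ => hx.1 k

variable [MeasurableSpace Ω]

/-- Measurable time sharing in which user `k` may be active only on the event `B k`. -/
structure IsSharing (B : ι → Set Ω) (τ : Ω → ι → ℝ) : Prop where
  measurable : Measurable τ
  nonneg : ∀ ω k, 0 ≤ τ ω k
  sum_eq_one : ∀ ω, ∑ k, τ ω k = 1
  eq_zero : ∀ ω k, ω ∉ B k → τ ω k = 0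

theorem IsSharing.le_one {B : ι → Set Ω} {τ : Ω → ι → ℝ} (hτ : IsSharing B τ) (ω : Ω) (k : ι) :
    τ ω k ≤ 1 := by
  rw [← hτ.sum_eq_one ω]
  exact Finset.single_le_sum (fun j _ => hτ.nonneg ω j) (Finset.mem_univ k)

theorem IsSharing.measurable_apply {B : ι → Set Ω} {τ : Ω → ι → ℝ} (hτ : IsSharing B τ) (k : ι) :
    Measurable fun ω => τ ω k := (measurable_pi_apply k).comp hτ.measurable

theorem IsSharing.integrable_mul {B : ι → Set Ω} {τ : Ω → ι → ℝ} (hτ : IsSharing B τ) (k : ι)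
    {P : Measure Ω} {f : Ω → ℝ} (hf : Integrable f P) : Integrable (fun ω => τ ω k * f ω) P := by
  refine hf.bdd_mul (c := 1) (hτ.measurable_apply k).aestronglyMeasurable ?_
  exact Eventually.of_forall fun ω => by
    rw [Real.norm_of_nonneg (hτ.nonneg ω k)]; exact hτ.le_one ω k

/-- All users `k` with `ω ∈ B k` are given equal times. -/
noncomputable def equalShare (B : ι → Set Ω) (ω : Ω) (k : ι) : ℝ :=
  (B k).indicator 1 ω / ∑ j, (B j).indicator (1 : Ω → ℝ) ω

theorem isSharing_equalShare {B : ι → Set Ω} (hB : ∀ k, MeasurableSet (B k))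
    (hcov : ∀ ω, ∃ k, ω ∈ B k) : IsSharing B (equalShare B) where
  measurable := by
    have h : ∀ k, Measurable ((B k).indicator (1 : Ω → ℝ)) :=
      fun k => measurable_one.indicator (hB k)
    exact measurable_pi_lambda _ fun k =>
      (h k).div (Finset.measurable_fun_sum _ fun j _ => h j)
  nonneg ω k := div_nonneg (Set.indicator_nonneg (fun _ _ => zero_le_one) _)
    (Finset.sum_nonneg fun _ _ => Set.indicator_nonneg (fun _ _ => zero_le_one) _)
  sum_eq_one ω := by
    obtain ⟨k, hk⟩ := hcov ω
    have : 0 < ∑ j, (B j).indicator (1 : Ω → ℝ) ω :=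
      Finset.sum_pos' (fun _ _ => Set.indicator_nonneg (fun _ _ => zero_le_one) _)
        ⟨k, Finset.mem_univ k, by simp [hk]⟩
    simp only [equalShare]
    rw [← Finset.sum_div, div_self this.ne']
  eq_zero ω k h := by simp [equalShare, h]

/-- The average rate vectors obtained by time sharing. -/
def sharedRates (P : Measure Ω) (B : ι → Set Ω) (r : ι → Ω → ℝ) : Set (ι → ℝ) :=
  {y | ∃ τ, IsSharing B τ ∧ ∀ k, y k = ∫ ω, τ ω k * r k ω ∂P}

theorem convex_sharedRates {P : Measure Ω} {B : ι → Set Ω} {r : ι → Ω → ℝ}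
    (hr : ∀ k, Integrable (r k) P) : Convex ℝ (sharedRates P B r) := by
  rintro x ⟨σ, hσ, hx⟩ y ⟨τ, hτ, hy⟩ a b ha hb hab
  refine ⟨fun ω k => a * σ ω k + b * τ ω k, ⟨?_, ?_, ?_, ?_⟩, fun k => ?_⟩
  · exact measurable_pi_lambda _ fun k =>
      ((hσ.measurable_apply k).const_mul a).add ((hτ.measurable_apply k).const_mul b)
  · intro ω k
    have := hσ.nonneg ω k
    have := hτ.nonneg ω k
    positivity
  · intro ω
    rw [Finset.sum_add_distrib, ← Finset.mul_sum, ← Finset.mul_sum, hσ.sum_eq_one,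
      hτ.sum_eq_one, mul_one, mul_one, hab]
  · intro ω k h
    simp [hσ.eq_zero ω k h, hτ.eq_zero ω k h]
  · have e : ∀ ω, (a * σ ω k + b * τ ω k) * r k ω =
        a * (σ ω k * r k ω) + b * (τ ω k * r k ω) := fun ω => by ring
    simp only [e]
    rw [integral_add ((hσ.integrable_mul k (hr k)).const_mul a)
      ((hτ.integrable_mul k (hr k)).const_mul b), integral_const_mul, integral_const_mul,
      ← hx, ← hy]
    rfl

theorem isClosed_setOf_ae_mem {E : Type*} [NormedAddCommGroup E] (P : Measure Ω)
    {C : Ω → Set E} (hC : ∀ ω, IsClosed (C ω)) :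
    IsClosed {f : Lp E 2 P | ∀ᵐ ω ∂P, f ω ∈ C ω} := by
  refine IsSeqClosed.isClosed fun f g hf hfg => ?_
  obtain ⟨ns, -, hns⟩ := (tendstoInMeasure_of_tendsto_Lp hfg).exists_seq_tendsto_ae
  have hall : ∀ᵐ ω ∂P, ∀ n, f n ω ∈ C ω := ae_all_iff.2 hf
  filter_upwards [hns, hall] with ω h1 h2
  exact (hC ω).mem_of_tendsto h1 (Eventually.of_forall fun i => h2 _)

end TDMA

namespace TDMA
open Filter Topology
variable {ι Ω : Type*} [Fintype ι]
variable [MeasurableSpace Ω]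

theorem isClosed_sharedRates {P : Measure Ω} [IsFiniteMeasure P] {B : ι → Set Ω}
    (hB : ∀ k, MeasurableSet (B k)) (hcov : ∀ ω, ∃ k, ω ∈ B k) {r : ι → Ω → ℝ}
    (hrm : ∀ k, Measurable (r k)) (hr0 : ∀ k ω, 0 ≤ r k ω) (hr : ∀ k, Integrable (r k) P) :
    IsClosed (sharedRates P B r) := by
  classical
  set s : Ω → ℝ := fun ω => √(1 + ∑ k, r k ω) with hs
  have hsum0 : ∀ ω, 0 ≤ ∑ k, r k ω := fun ω => Finset.sum_nonneg fun k _ => hr0 k ω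
  have hs0 : ∀ ω, 0 < s ω := fun ω => Real.sqrt_pos.2 (by linarith [hsum0 ω])
  have hssq : ∀ ω, s ω ^ 2 = 1 + ∑ k, r k ω := fun ω => Real.sq_sqrt (by linarith [hsum0 ω])
  have hsm : Measurable s := (measurable_const.add
    (Finset.measurable_fun_sum _ fun k _ => hrm k)).sqrt
  have hsL : MemLp s 2 P := by
    rw [memLp_two_iff_integrable_sq hsm.aestronglyMeasurable]
    simp only [hssq]
    exact (integrable_const 1).add (integrable_finsetSum _ fun k _ => hr k)
  set w : ι → Ω → EuclideanSpace ℝ ι := fun k ω => EuclideanSpace.single k (r k ω / s ω) with hw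
  have hwm : ∀ k, Measurable (w k) := fun k => by
    have h1 : Measurable fun ω => (Pi.single k (r k ω / s ω) : ι → ℝ) :=
      (measurable_pi_lambda _ fun j => by
        by_cases h : j = k
        · subst h; simp only [Pi.single_eq_same]; exact (hrm j).div hsm
        · simp [h])
    exact (WithLp.measurable_toLp 2 _).comp h1
  have hwL : ∀ k, MemLp (w k) 2 P := fun k => by
    refine hsL.mono (hwm k).aestronglyMeasurable (Eventually.of_forall fun ω => ?_)
    rw [Real.norm_of_nonneg (hs0 ω).le, hw, PiLp.norm_single,
      Real.norm_of_nonneg (div_nonneg (hr0 k ω) (hs0 ω).le), div_le_iff₀ (hs0 ω), ← sq, hssq]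
    have := Finset.single_le_sum (fun j _ => hr0 j ω) (Finset.mem_univ k)
    linarith
  set T : Set (Lp (EuclideanSpace ℝ ι) 2 P) := {f | ∀ᵐ ω ∂P, f ω ∈ activeSimplex B s ω} with hT
  have hTcl : IsClosed T := isClosed_setOf_ae_mem P fun ω => isClosed_activeSimplex B s ω
  have hTconv : Convex ℝ T := by
    intro f hf g hg a b ha hb hab
    filter_upwards [hf, hg, Lp.coeFn_add (a • f) (b • g), Lp.coeFn_smul a f, Lp.coeFn_smul b g]
      with ω h1 h2 h3 h4 h5
    rw [h3, Pi.add_apply, h4, h5]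
    exact convex_activeSimplex B s ω h1 h2 ha hb hab
  have hTb : Bornology.IsBounded T := by
    refine (isBounded_iff_forall_norm_le).2 ⟨‖hsL.toLp s‖, fun f hf => ?_⟩
    refine Lp.norm_le_norm_of_ae_le ?_
    filter_upwards [hf, hsL.coeFn_toLp] with ω h1 h2
    rw [h2, Real.norm_of_nonneg (hs0 ω).le]
    exact norm_le_of_mem_activeSimplex h1
  set L : Lp (EuclideanSpace ℝ ι) 2 P →L[ℝ] (ι → ℝ) :=
    ContinuousLinearMap.pi fun k => innerSL ℝ ((hwL k).toLp (w k)) with hL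
  have hLapp : ∀ f k, L f k = ∫ ω, f ω k * (r k ω / s ω) ∂P := by
    intro f k
    change inner ℝ ((hwL k).toLp (w k)) f = _
    rw [L2.inner_def]
    refine integral_congr_ae ?_
    filter_upwards [(hwL k).coeFn_toLp] with ω h
    rw [h, hw, EuclideanSpace.inner_single_left]
    simp [mul_comm]
  suffices h : sharedRates P B r = L '' T by
    rw [h]; exact isClosed_image_of_convex_bounded hTcl hTconv hTb L
  ext y
  constructor
  · rintro ⟨τ, hτ, hy⟩
    set f : Ω → EuclideanSpace ℝ ι := fun ω => WithLp.toLp 2 (fun k => s ω * τ ω k) with hf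
    have hmem : ∀ ω, f ω ∈ activeSimplex B s ω := fun ω => by
      refine ⟨fun k => mul_nonneg (hs0 ω).le (hτ.nonneg ω k), ?_, fun k h => ?_⟩
      · change ∑ k, s ω * τ ω k = s ω
        rw [← Finset.mul_sum, hτ.sum_eq_one, mul_one]
      · change s ω * τ ω k = 0
        rw [hτ.eq_zero ω k h, mul_zero]
    have hfm : Measurable f := (WithLp.measurable_toLp 2 _).comp
      (measurable_pi_lambda _ fun k => hsm.mul (hτ.measurable_apply k))
    have hfL : MemLp f 2 P := by
      refine hsL.mono hfm.aestronglyMeasurable (Eventually.of_forall fun ω => ?_)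
      rw [Real.norm_of_nonneg (hs0 ω).le]
      exact norm_le_of_mem_activeSimplex (hmem ω)
    refine ⟨hfL.toLp f, ?_, ?_⟩
    · filter_upwards [hfL.coeFn_toLp] with ω h
      rw [h]; exact hmem ω
    · ext k
      rw [hLapp, hy]
      refine integral_congr_ae ?_
      filter_upwards [hfL.coeFn_toLp] with ω h
      rw [h]
      change s ω * τ ω k * (r k ω / s ω) = _
      have := (hs0 ω).ne'
      field_simp
  · rintro ⟨f, hf, rfl⟩
    have hfm : Measurable fun ω => f ω := (Lp.stronglyMeasurable f).measurable
    have hfk : ∀ k, Measurable fun ω => f ω k := fun k =>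
      (measurable_pi_apply k).comp ((WithLp.measurable_ofLp 2 _).comp hfm)
    have hset : MeasurableSet {ω | f ω ∈ activeSimplex B s ω} := by
      have e : {ω | f ω ∈ activeSimplex B s ω} = (⋂ k, {ω | 0 ≤ f ω k}) ∩
          ({ω | ∑ k, f ω k = s ω} ∩ ⋂ k, (B k ∪ {ω | f ω k = 0})) := by
        ext ω; simp [activeSimplex, or_iff_not_imp_left]
      rw [e]
      refine (MeasurableSet.iInter fun k => measurableSet_le measurable_const (hfk k)).inter
        ((measurableSet_eq_fun (Finset.measurable_fun_sum _ fun k _ => hfk k) hsm).inter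
        (MeasurableSet.iInter fun k => (hB k).union
          (measurableSet_eq_fun (hfk k) measurable_const)))
    have he := isSharing_equalShare hB hcov
    refine ⟨fun ω k => if f ω ∈ activeSimplex B s ω then f ω k / s ω else equalShare B ω k,
      ⟨?_, ?_, ?_, ?_⟩, fun k => ?_⟩
    · exact measurable_pi_lambda _ fun k =>
        Measurable.ite hset ((hfk k).div hsm) (he.measurable_apply k)
    · intro ω k
      dsimp only
      split_ifs with h
      · exact div_nonneg (h.1 k) (hs0 ω).le
      · exact he.nonneg ω k
    · intro ω
      dsimp only
      split_ifs with h
      · rw [← Finset.sum_div, h.2.1, div_self (hs0 ω).ne']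
      · exact he.sum_eq_one ω
    · intro ω k hk
      dsimp only
      split_ifs with h
      · rw [h.2.2 k hk, zero_div]
      · exact he.eq_zero ω k hk
    · rw [hLapp]
      refine integral_congr_ae ?_
      filter_upwards [hf] with ω h
      rw [if_pos h]
      ring

theorem mem_sharedRates_of_forall_direction {P : Measure Ω} [IsFiniteMeasure P] {B : ι → Set Ω}
    (hB : ∀ k, MeasurableSet (B k)) (hcov : ∀ ω, ∃ k, ω ∈ B k) {r : ι → Ω → ℝ}
    (hrm : ∀ k, Measurable (r k)) (hr0 : ∀ k ω, 0 ≤ r k ω) (hr : ∀ k, Integrable (r k) P)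
    {x : ι → ℝ} (hx : ∀ d : ι → ℝ, ∃ y ∈ sharedRates P B r, ∑ k, d k * x k ≤ ∑ k, d k * y k) :
    x ∈ sharedRates P B r := by
  classical
  by_contra hmem
  obtain ⟨f, u, hu, hub⟩ := geometric_hahn_banach_closed_point (convex_sharedRates hr)
    (isClosed_sharedRates hB hcov hrm hr0 hr) hmem
  have hf : ∀ y : ι → ℝ, f y = ∑ k, f (Pi.single k 1) * y k := fun y => by
    conv_lhs => rw [pi_eq_sum_univ' y, map_sum]
    refine Finset.sum_congr rfl fun k _ => ?_
    rw [map_smul, smul_eq_mul, mul_comm]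
  obtain ⟨y, hy, hle⟩ := hx fun k => f (Pi.single k 1)
  rw [← hf, ← hf] at hle
  linarith [hu y hy]

end TDMA

namespace TDMA
open Filter Topology
variable {ι Ω : Type*} [Fintype ι]

/-- The fading states in which user `k` has the largest surplus. -/
def bestSet (m : ι → ℝ) (γ : ι → Ω → ℝ) (lam : ι → ℝ) (k : ι) : Set Ω :=
  {ω | ∀ j, surplus (m j) (lam j) (γ j ω) ≤ surplus (m k) (lam k) (γ k ω)}

theorem exists_mem_bestSet [Nonempty ι] (m : ι → ℝ) (γ : ι → Ω → ℝ) (lam : ι → ℝ) (ω : Ω) :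
    ∃ k, ω ∈ bestSet m γ lam k :=
  Finite.exists_max fun k => surplus (m k) (lam k) (γ k ω)

/-- The largest surplus among the users. -/
noncomputable def maxSurplus [Nonempty ι] (m : ι → ℝ) (γ : ι → Ω → ℝ) (lam : ι → ℝ) (ω : Ω) : ℝ :=
  Finset.univ.sup' Finset.univ_nonempty fun k => surplus (m k) (lam k) (γ k ω)

theorem surplus_le_maxSurplus [Nonempty ι] (m : ι → ℝ) (γ : ι → Ω → ℝ) (lam : ι → ℝ) (ω : Ω)
    (k : ι) : surplus (m k) (lam k) (γ k ω) ≤ maxSurplus m γ lam ω :=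
  Finset.le_sup' (fun k => surplus (m k) (lam k) (γ k ω)) (Finset.mem_univ k)

theorem maxSurplus_eq_of_mem_bestSet [Nonempty ι] {m : ι → ℝ} {γ : ι → Ω → ℝ} {lam : ι → ℝ}
    {ω : Ω} {k : ι} (h : ω ∈ bestSet m γ lam k) :
    maxSurplus m γ lam ω = surplus (m k) (lam k) (γ k ω) :=
  le_antisymm (Finset.sup'_le _ _ fun j _ => h j) (surplus_le_maxSurplus m γ lam ω k)

theorem continuous_maxSurplus [Nonempty ι] (m : ι → ℝ) (γ : ι → Ω → ℝ) (ω : Ω) :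
    Continuous fun lam => maxSurplus m γ lam ω :=
  Continuous.finset_sup'_apply _ fun k _ =>
    (continuous_surplus (m k) (γ k ω)).comp (continuous_apply k)

theorem norm_maxSurplus_le [Nonempty ι] {m : ι → ℝ} {γ : ι → Ω → ℝ} (hm : ∀ k, 0 < m k) (hγ : ∀ k ω, 0 < γ k ω)
    {lam : ι → ℝ} {c : ℝ} (hc : 0 ≤ c) (hlam : ∀ k, lam k ≤ c) (ω : Ω) :
    ‖maxSurplus m γ lam ω‖ ≤ ∑ k, c * waterRate (m k) c (γ k ω) := by
  obtain ⟨k, hk⟩ := exists_mem_bestSet m γ lam ω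
  rw [maxSurplus_eq_of_mem_bestSet hk, Real.norm_of_nonneg (surplus_nonneg _ (hm k) (hγ k ω))]
  calc surplus (m k) (lam k) (γ k ω) ≤ surplus (m k) c (γ k ω) :=
        surplus_mono (hm k) (hγ k ω) (hlam k)
    _ ≤ c * waterRate (m k) c (γ k ω) := surplus_le (hm k) (hγ k ω)
    _ ≤ _ := Finset.single_le_sum (f := fun k => c * waterRate (m k) c (γ k ω))
        (fun j _ => mul_nonneg hc (waterRate_nonneg _ _ _)) (Finset.mem_univ k)

variable [MeasurableSpace Ω]

theorem measurable_maxSurplus [Nonempty ι] (m : ι → ℝ) {γ : ι → Ω → ℝ}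
    (hγm : ∀ k, Measurable (γ k)) (lam : ι → ℝ) : Measurable (maxSurplus m γ lam) := by
  have := Finset.measurable_sup' (Finset.univ_nonempty (α := ι))
    (f := fun k ω => surplus (m k) (lam k) (γ k ω))
    fun k _ => (measurable_surplus (m k) (lam k)).comp (hγm k)
  convert this using 1
  ext ω
  simp [maxSurplus, Finset.sup'_apply]

theorem measurableSet_bestSet (m : ι → ℝ) {γ : ι → Ω → ℝ} (hγm : ∀ k, Measurable (γ k))
    (lam : ι → ℝ) (k : ι) : MeasurableSet (bestSet m γ lam k) := by
  have e : bestSet m γ lam k =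
      ⋂ j, {ω | surplus (m j) (lam j) (γ j ω) ≤ surplus (m k) (lam k) (γ k ω)} := by
    ext ω; simp [bestSet]
  rw [e]
  exact MeasurableSet.iInter fun j => measurableSet_le
    ((measurable_surplus _ _).comp (hγm j)) ((measurable_surplus _ _).comp (hγm k))

variable {P : Measure Ω} {m : ι → ℝ} {γ : ι → Ω → ℝ}

theorem isSharing_equalShare_bestSet [Nonempty ι] (m : ι → ℝ) (hγm : ∀ k, Measurable (γ k))
    (lam : ι → ℝ) : IsSharing (bestSet m γ lam) (equalShare (bestSet m γ lam)) :=
  isSharing_equalShare (measurableSet_bestSet m hγm lam) (exists_mem_bestSet m γ lam)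

theorem integrable_sum_waterRate [IsFiniteMeasure P] (hm : ∀ k, 0 < m k) (hγ : ∀ k ω, 0 < γ k ω)
    (hγm : ∀ k, Measurable (γ k)) (hcap : ∀ k, Integrable (fun ω => Real.log (1 + γ k ω)) P)
    (c : ι → ℝ) (l : ι → ℝ) :
    Integrable (fun ω => ∑ k, c k * waterRate (m k) (l k) (γ k ω)) P :=
  integrable_finsetSum _ fun k _ =>
    (integrable_waterRate (hm k) (hγ k) (hγm k) (hcap k) _).const_mul _

theorem integrable_maxSurplus [Nonempty ι] [IsFiniteMeasure P] (hm : ∀ k, 0 < m k)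
    (hγ : ∀ k ω, 0 < γ k ω) (hγm : ∀ k, Measurable (γ k))
    (hcap : ∀ k, Integrable (fun ω => Real.log (1 + γ k ω)) P) (lam : ι → ℝ) :
    Integrable (maxSurplus m γ lam) P := by
  refine (integrable_sum_waterRate hm hγ hγm hcap (fun _ => ‖lam‖) fun _ => ‖lam‖).mono'
    (measurable_maxSurplus m hγm lam).aestronglyMeasurable (Eventually.of_forall fun ω => ?_)
  exact norm_maxSurplus_le hm hγ (norm_nonneg _)
    (fun k => (le_abs_self _).trans (norm_le_pi_norm lam k)) ω

/-- The dual function with its sign reversed. -/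
noncomputable def dualLoss [Nonempty ι] (P : Measure Ω) (m : ι → ℝ) (γ : ι → Ω → ℝ) (R : ι → ℝ)
    (lam : ι → ℝ) : ℝ :=
  ∫ ω, maxSurplus m γ lam ω ∂P - ∑ k, R k * lam k

theorem continuous_dualLoss [Nonempty ι] [IsFiniteMeasure P] (hm : ∀ k, 0 < m k)
    (hγ : ∀ k ω, 0 < γ k ω) (hγm : ∀ k, Measurable (γ k))
    (hcap : ∀ k, Integrable (fun ω => Real.log (1 + γ k ω)) P) (R : ι → ℝ) :
    Continuous (dualLoss P m γ R) := by
  refine Continuous.sub (continuous_iff_continuousAt.2 fun lam => ?_) (by fun_prop)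
  refine continuousAt_of_dominated (bound := fun ω =>
    ∑ k, (‖lam‖ + 1) * waterRate (m k) (‖lam‖ + 1) (γ k ω))
    (Eventually.of_forall fun l => (measurable_maxSurplus m hγm l).aestronglyMeasurable) ?_
    (integrable_sum_waterRate hm hγ hγm hcap _ _)
    (Eventually.of_forall fun ω => (continuous_maxSurplus m γ ω).continuousAt)
  have h1 : ∀ᶠ l : ι → ℝ in 𝓝 lam, ‖l‖ < ‖lam‖ + 1 :=
    continuous_norm.continuousAt.eventually_lt continuousAt_const (by linarith)
  filter_upwards [h1] with l hl
  exact Eventually.of_forall fun ω => norm_maxSurplus_le hm hγ (by positivity)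
    (fun k => ((le_abs_self _).trans (norm_le_pi_norm l k)).trans hl.le) ω

theorem exists_integral_maxSurplus_lower_bound [Nonempty ι] [IsProbabilityMeasure P]
    (hm : ∀ k, 0 < m k) (hγ : ∀ k ω, 0 < γ k ω) (hγm : ∀ k, Measurable (γ k))
    (hcap : ∀ k, Integrable (fun ω => Real.log (1 + γ k ω)) P) (k : ι) {a : ℝ} (ha : 0 ≤ a) :
    ∃ C : ℝ, ∀ lam : ι → ℝ, a * lam k - C ≤ ∫ ω, maxSurplus m γ lam ω ∂P := by
  obtain ⟨ε, hε, hpos⟩ : ∃ ε : ℝ, 0 < ε ∧ 0 < P.real {ω | ε ≤ γ k ω} := by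
    by_contra! h
    have h0 : ∀ n : ℕ, P {ω | 1 / ((n : ℝ) + 1) ≤ γ k ω} = 0 := fun n => by
      have := le_antisymm (h (1 / ((n : ℝ) + 1)) Nat.one_div_pos_of_nat) measureReal_nonneg
      exact (measureReal_eq_zero_iff).1 this
    have hun : (⋃ n : ℕ, {ω | 1 / ((n : ℝ) + 1) ≤ γ k ω}) = Set.univ := by
      refine Set.eq_univ_of_forall fun ω => ?_
      obtain ⟨n, hn⟩ := exists_nat_one_div_lt (hγ k ω)
      exact Set.mem_iUnion.2 ⟨n, hn.le⟩
    have := measure_iUnion_null h0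
    rw [hun, measure_univ] at this
    exact one_ne_zero this
  set A : Set Ω := {ω | ε ≤ γ k ω} with hA
  have hAm : MeasurableSet A := measurableSet_le measurable_const (hγm k)
  set x : ℝ := a / P.real A with hx
  have hx0 : 0 ≤ x := by positivity
  have hpow : (1 : ℝ) ≤ 2 ^ x := Real.one_le_rpow (by norm_num) hx0
  refine ⟨P.real A * (m k / ε * (2 ^ x - 1)), fun lam => ?_⟩
  have hle : ∫ ω, A.indicator (fun _ => lam k * x - m k / ε * ((2 : ℝ) ^ x - 1)) ω ∂P ≤
      ∫ ω, maxSurplus m γ lam ω ∂P := by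
    refine integral_mono ((integrable_const _).indicator hAm)
      (integrable_maxSurplus hm hγ hγm hcap lam) fun ω => ?_
    have h1 := surplus_le_maxSurplus m γ lam ω k
    by_cases h : ω ∈ A
    · rw [Set.indicator_of_mem h]
      refine le_trans ?_ ((le_surplus (lam k) (hm k) (hγ k ω) hx0).trans h1)
      have h2 : m k / γ k ω ≤ m k / ε := div_le_div_of_nonneg_left (hm k).le hε h
      have := mul_le_mul_of_nonneg_right h2 (sub_nonneg.2 hpow)
      linarith
    · rw [Set.indicator_of_notMem h]
      exact (surplus_nonneg _ (hm k) (hγ k ω)).trans h1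
  rw [integral_indicator_const _ hAm, smul_eq_mul] at hle
  refine le_trans (le_of_eq ?_) hle
  rw [hx]
  field_simp

theorem tendsto_dualLoss_atTop [Nonempty ι] [IsProbabilityMeasure P]
    (hm : ∀ k, 0 < m k) (hγ : ∀ k ω, 0 < γ k ω) (hγm : ∀ k, Measurable (γ k))
    (hcap : ∀ k, Integrable (fun ω => Real.log (1 + γ k ω)) P) {R : ι → ℝ} (hR : ∀ k, 0 < R k) :
    Tendsto (dualLoss P m γ R) (cocompact (ι → ℝ)) atTop := by
  set N : ℝ := (Fintype.card ι : ℝ) with hN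
  have hN0 : 0 < N := by rw [hN]; exact_mod_cast Fintype.card_pos
  choose C hC using fun k => exists_integral_maxSurplus_lower_bound (P := P) hm hγ hγm hcap k
    (a := N * (2 * R k)) (by have := hR k; positivity)
  have hG : ∀ lam, 0 ≤ ∫ ω, maxSurplus m γ lam ω ∂P := fun lam => by
    refine integral_nonneg fun ω => ?_
    obtain ⟨k, hk⟩ := exists_mem_bestSet m γ lam ω
    rw [maxSurplus_eq_of_mem_bestSet hk]
    exact surplus_nonneg _ (hm k) (hγ k ω)
  obtain ⟨k0, hk0⟩ := Finite.exists_min R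
  have hbound : ∀ lam, R k0 * ‖lam‖ - ∑ k, |C k| / N ≤ dualLoss P m γ R lam := by
    intro lam
    have h1 : ∀ k, R k * |lam k| + R k * lam k - |C k| / N ≤
        (∫ ω, maxSurplus m γ lam ω ∂P) / N := by
      intro k
      rw [le_div_iff₀ hN0, sub_mul, div_mul_cancel₀ _ hN0.ne']
      rcases le_total 0 (lam k) with h | h
      · rw [abs_of_nonneg h]
        have := hC k lam
        have := le_abs_self (C k)
        nlinarith
      · rw [abs_of_nonpos h]
        have := hG lam
        have := abs_nonneg (C k)
        nlinarith
    have h2 := Finset.sum_le_sum fun k (_ : k ∈ Finset.univ) => h1 k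
    rw [Finset.sum_const, Finset.card_univ, nsmul_eq_mul, mul_div_cancel₀ _ hN0.ne',
      Finset.sum_sub_distrib, Finset.sum_add_distrib] at h2
    have h3 : R k0 * ‖lam‖ ≤ ∑ k, R k * |lam k| := by
      rw [← le_div_iff₀' (hR k0), pi_norm_le_iff_of_nonneg
        (div_nonneg (Finset.sum_nonneg fun k _ => mul_nonneg (hR k).le (abs_nonneg _)) (hR k0).le)]
      intro k
      rw [le_div_iff₀' (hR k0), Real.norm_eq_abs]
      exact (mul_le_mul_of_nonneg_right (hk0 k) (abs_nonneg _)).trans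
        (Finset.single_le_sum (f := fun k => R k * |lam k|)
          (fun j _ => mul_nonneg (hR j).le (abs_nonneg _)) (Finset.mem_univ k))
    rw [dualLoss]
    linarith
  refine tendsto_atTop_mono hbound ?_
  exact tendsto_atTop_add_const_right _ _
    ((tendsto_norm_cocompact_atTop (E := ι → ℝ)).const_mul_atTop (hR k0))

end TDMA

namespace TDMA
open Filter Topology
variable {ι Ω : Type*} [Fintype ι]
variable {m : ι → ℝ} {γ : ι → Ω → ℝ}

theorem eventually_best_rate_lt (lam d : ι → ℝ) {ω : Ω} {c : ℝ}
    (hc : ∀ k, ω ∈ bestSet m γ lam k → d k * waterRate (m k) (lam k) (γ k ω) < c) :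
    ∀ᶠ ε : ℝ in 𝓝 0, ∀ k, ω ∈ bestSet m γ (fun k => lam k + ε * d k) k →
      d k * waterRate (m k) (lam k + ε * d k) (γ k ω) < c := by
  rw [eventually_all]
  intro k
  have hl : ∀ j, Continuous fun ε : ℝ => lam j + ε * d j := fun j => by fun_prop
  by_cases hk : ω ∈ bestSet m γ lam k
  · have hcont : Continuous fun ε : ℝ => d k * waterRate (m k) (lam k + ε * d k) (γ k ω) :=
      continuous_const.mul ((continuous_waterRate (m k) (γ k ω)).comp (hl k))
    have := hcont.continuousAt.eventually_lt (x₀ := (0 : ℝ)) continuousAt_const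
      (by simpa using hc k hk)
    filter_upwards [this] with ε hε _ using hε
  · simp only [bestSet, Set.mem_ofPred_eq, not_forall, not_le] at hk
    obtain ⟨j, hj⟩ := hk
    have h1 := (continuous_surplus (m k) (γ k ω)).comp (hl k)
    have h2 := (continuous_surplus (m j) (γ j ω)).comp (hl j)
    have := h1.continuousAt.eventually_lt (x₀ := (0 : ℝ)) h2.continuousAt (by simpa using hj)
    filter_upwards [this] with ε hε hbest
    exact absurd (hbest j) (not_le.2 hε)

variable [MeasurableSpace Ω] {P : Measure Ω}

theorem IsSharing.le_sum_mul {B : ι → Set Ω} {τ : Ω → ι → ℝ} (hτ : IsSharing B τ) {ω : Ω}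
    {a : ι → ℝ} {c : ℝ} (h : ∀ k, ω ∈ B k → c ≤ a k) : c ≤ ∑ k, τ ω k * a k := by
  calc c = ∑ k, τ ω k * c := by rw [← Finset.sum_mul, hτ.sum_eq_one, one_mul]
    _ ≤ _ := Finset.sum_le_sum fun k _ => by
      by_cases hk : ω ∈ B k
      · exact mul_le_mul_of_nonneg_left (h k hk) (hτ.nonneg ω k)
      · simp [hτ.eq_zero ω k hk]

theorem IsSharing.sum_mul_le {B : ι → Set Ω} {τ : Ω → ι → ℝ} (hτ : IsSharing B τ) {ω : Ω}
    {a : ι → ℝ} {c : ℝ} (h : ∀ k, ω ∈ B k → a k ≤ c) : ∑ k, τ ω k * a k ≤ c := by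
  have := hτ.le_sum_mul (ω := ω) (a := fun k => -a k) (c := -c) fun k hk => neg_le_neg (h k hk)
  simp only [mul_neg, Finset.sum_neg_distrib] at this
  exact neg_le_neg_iff.1 this

theorem IsSharing.mono {B B' : ι → Set Ω} {τ : Ω → ι → ℝ} (hτ : IsSharing B τ)
    (h : ∀ k, B k ⊆ B' k) : IsSharing B' τ :=
  ⟨hτ.measurable, hτ.nonneg, hτ.sum_eq_one, fun ω k hk => hτ.eq_zero ω k fun h' => hk (h k h')⟩

theorem IsSharing.abs_sum_mul_waterRate_le {B : ι → Set Ω} {τ : Ω → ι → ℝ} (hτ : IsSharing B τ)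
    (hm : ∀ k, 0 < m k) (hγ : ∀ k ω, 0 < γ k ω) (d : ι → ℝ) {l l' : ι → ℝ}
    (hl : ∀ k, l k ≤ l' k) (ω : Ω) :
    |∑ k, τ ω k * (d k * waterRate (m k) (l k) (γ k ω))| ≤
      ∑ k, |d k| * waterRate (m k) (l' k) (γ k ω) := by
  refine (Finset.abs_sum_le_sum_abs _ _).trans (Finset.sum_le_sum fun k _ => ?_)
  rw [abs_mul, abs_mul, abs_of_nonneg (hτ.nonneg ω k), abs_of_nonneg (waterRate_nonneg _ _ _)]
  have h1 := waterRate_mono (hm k) (hγ k ω) (hl k)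
  have h2 := waterRate_nonneg (m k) (l k) (γ k ω)
  calc _ ≤ 1 * (|d k| * waterRate (m k) (l k) (γ k ω)) :=
        mul_le_mul_of_nonneg_right (hτ.le_one ω k) (by positivity)
    _ ≤ _ := by rw [one_mul]; exact mul_le_mul_of_nonneg_left h1 (abs_nonneg _)

theorem IsSharing.measurable_sum_mul_waterRate {B : ι → Set Ω} {τ : Ω → ι → ℝ}
    (hτ : IsSharing B τ) (hγm : ∀ k, Measurable (γ k)) (d l : ι → ℝ) :
    Measurable fun ω => ∑ k, τ ω k * (d k * waterRate (m k) (l k) (γ k ω)) :=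
  Finset.measurable_fun_sum _ fun k _ => (hτ.measurable_apply k).mul
    (((measurable_waterRate _ _).comp (hγm k)).const_mul _)

theorem IsSharing.integrable_sum_mul_waterRate {B : ι → Set Ω} {τ : Ω → ι → ℝ}
    [IsFiniteMeasure P] (hτ : IsSharing B τ) (hm : ∀ k, 0 < m k) (hγ : ∀ k ω, 0 < γ k ω)
    (hγm : ∀ k, Measurable (γ k)) (hcap : ∀ k, Integrable (fun ω => Real.log (1 + γ k ω)) P)
    (d l : ι → ℝ) :
    Integrable (fun ω => ∑ k, τ ω k * (d k * waterRate (m k) (l k) (γ k ω))) P :=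
  (integrable_sum_waterRate hm hγ hγm hcap _ _).mono'
    (hτ.measurable_sum_mul_waterRate hγm d l).aestronglyMeasurable
    (Eventually.of_forall fun ω => hτ.abs_sum_mul_waterRate_le hm hγ d (fun _ => le_rfl) ω)

theorem dualLoss_sub_le [Nonempty ι] [IsFiniteMeasure P] (hm : ∀ k, 0 < m k)
    (hγ : ∀ k ω, 0 < γ k ω) (hγm : ∀ k, Measurable (γ k))
    (hcap : ∀ k, Integrable (fun ω => Real.log (1 + γ k ω)) P) (R lam d : ι → ℝ) (ε : ℝ)
    {σ : Ω → ι → ℝ} (hσ : IsSharing (bestSet m γ fun k => lam k + ε * d k) σ) :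
    dualLoss P m γ R (fun k => lam k + ε * d k) - dualLoss P m γ R lam ≤
      ε * (∫ ω, ∑ k, σ ω k * (d k * waterRate (m k) (lam k + ε * d k) (γ k ω)) ∂P -
        ∑ k, d k * R k) := by
  have hpt : ∀ ω, maxSurplus m γ (fun k => lam k + ε * d k) ω - maxSurplus m γ lam ω ≤
      ε * ∑ k, σ ω k * (d k * waterRate (m k) (lam k + ε * d k) (γ k ω)) := by
    intro ω
    rw [Finset.mul_sum]
    simp only [mul_left_comm ε]
    refine hσ.le_sum_mul fun k hk => ?_
    rw [maxSurplus_eq_of_mem_bestSet hk]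
    have h1 := surplus_le_maxSurplus m γ lam ω k
    have h2 := surplus_subgradient (lam k + ε * d k) (lam k) (hm k) (hγ k ω)
    linarith
  have h := integral_mono ((integrable_maxSurplus hm hγ hγm hcap _).sub
    (integrable_maxSurplus hm hγ hγm hcap lam))
    ((hσ.integrable_sum_mul_waterRate hm hγ hγm hcap d _).const_mul ε) hpt
  rw [integral_const_mul, integral_sub' (integrable_maxSurplus hm hγ hγm hcap _)
    (integrable_maxSurplus hm hγ hγm hcap lam)] at h
  have e : ∑ k, R k * (lam k + ε * d k) = ∑ k, R k * lam k + ε * ∑ k, d k * R k := by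
    rw [Finset.mul_sum, ← Finset.sum_add_distrib]
    exact Finset.sum_congr rfl fun k _ => by ring
  rw [dualLoss, dualLoss, e]
  linarith

/-- Among the best users, those whose rates grow fastest in the direction `d`. -/
def steepestSet (m : ι → ℝ) (γ : ι → Ω → ℝ) (lam d : ι → ℝ) (k : ι) : Set Ω :=
  bestSet m γ lam k ∩ {ω | ∀ j, ω ∈ bestSet m γ lam j →
    d j * waterRate (m j) (lam j) (γ j ω) ≤ d k * waterRate (m k) (lam k) (γ k ω)}

theorem isSharing_equalShare_steepestSet [Nonempty ι] (m : ι → ℝ) (hγm : ∀ k, Measurable (γ k))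
    (lam d : ι → ℝ) :
    IsSharing (steepestSet m γ lam d) (equalShare (steepestSet m γ lam d)) := by
  classical
  refine isSharing_equalShare (fun k => (measurableSet_bestSet m hγm lam k).inter ?_) fun ω => ?_
  · have e : {ω | ∀ j, ω ∈ bestSet m γ lam j →
        d j * waterRate (m j) (lam j) (γ j ω) ≤ d k * waterRate (m k) (lam k) (γ k ω)} =
        ⋂ j, ((bestSet m γ lam j)ᶜ ∪ {ω |
          d j * waterRate (m j) (lam j) (γ j ω) ≤ d k * waterRate (m k) (lam k) (γ k ω)}) := by
      ext ω; simp [imp_iff_not_or]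
    rw [e]
    exact MeasurableSet.iInter fun j => (measurableSet_bestSet m hγm lam j).compl.union
      (measurableSet_le (((measurable_waterRate _ _).comp (hγm j)).const_mul _)
        (((measurable_waterRate _ _).comp (hγm k)).const_mul _))
  · obtain ⟨i, hi⟩ := exists_mem_bestSet m γ lam ω
    obtain ⟨k, hk, hmax⟩ := Finset.exists_max_image
      (Finset.univ.filter fun j => ω ∈ bestSet m γ lam j)
      (fun j => d j * waterRate (m j) (lam j) (γ j ω)) ⟨i, by simpa using hi⟩
    exact ⟨k, by simpa using hk, fun j hj => hmax j (by simpa using hj)⟩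

theorem exists_sharedRates_ge_of_isMin [Nonempty ι] [IsFiniteMeasure P] (hm : ∀ k, 0 < m k)
    (hγ : ∀ k ω, 0 < γ k ω) (hγm : ∀ k, Measurable (γ k))
    (hcap : ∀ k, Integrable (fun ω => Real.log (1 + γ k ω)) P) {R lam : ι → ℝ}
    (hmin : ∀ l, dualLoss P m γ R lam ≤ dualLoss P m γ R l) (d : ι → ℝ) :
    ∃ y ∈ sharedRates P (bestSet m γ lam) (fun k ω => waterRate (m k) (lam k) (γ k ω)),
      ∑ k, d k * R k ≤ ∑ k, d k * y k := by
  have hτ := isSharing_equalShare_steepestSet m hγm lam d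
  set τ := equalShare (steepestSet m γ lam d)
  refine ⟨fun k => ∫ ω, τ ω k * waterRate (m k) (lam k) (γ k ω) ∂P,
    ⟨τ, hτ.mono fun k => Set.inter_subset_left, fun k => rfl⟩, ?_⟩
  set b : Ω → ℝ := fun ω => ∑ k, τ ω k * (d k * waterRate (m k) (lam k) (γ k ω)) with hb
  have hbint : ∫ ω, b ω ∂P = ∑ k, d k * ∫ ω, τ ω k * waterRate (m k) (lam k) (γ k ω) ∂P := by
    simp only [hb, mul_left_comm _ (d _)]
    rw [integral_finsetSum _ fun k _ => (hτ.integrable_mul k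
      (integrable_waterRate (hm k) (hγ k) (hγm k) (hcap k) _)).const_mul _]
    simp only [integral_const_mul]
  rw [← hbint]
  set σ : ℝ → Ω → ι → ℝ := fun ε => equalShare (bestSet m γ fun k => lam k + ε * d k) with hσd
  have hσ : ∀ ε, IsSharing (bestSet m γ fun k => lam k + ε * d k) (σ ε) :=
    fun ε => isSharing_equalShare_bestSet m hγm _
  set a : ℝ → Ω → ℝ := fun ε ω =>
    ∑ k, σ ε ω k * (d k * waterRate (m k) (lam k + ε * d k) (γ k ω)) with ha
  have hle : ∀ ε, 0 < ε → ∑ k, d k * R k ≤ ∫ ω, a ε ω ∂P := by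
    intro ε hε
    have h1 := dualLoss_sub_le hm hγ hγm hcap R lam d ε (hσ ε)
    have h2 := hmin fun k => lam k + ε * d k
    exact sub_nonneg.1 (nonneg_of_mul_nonneg_right ((sub_nonneg.2 h2).trans h1) hε)
  have hbm : Measurable b := hτ.measurable_sum_mul_waterRate hγm d lam
  have ham : ∀ ε, Measurable (a ε) := fun ε => (hσ ε).measurable_sum_mul_waterRate hγm d _
  have hlim : Tendsto (fun ε => ∫ ω, max (a ε ω) (b ω) ∂P) (𝓝[>] 0) (𝓝 (∫ ω, b ω ∂P)) := by
    refine tendsto_integral_filter_of_dominated_convergence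
      (fun ω => ∑ k, |d k| * waterRate (m k) (|lam k| + |d k|) (γ k ω))
      (Eventually.of_forall fun ε => ((ham ε).max hbm).aestronglyMeasurable) ?_
      (integrable_sum_waterRate hm hγ hγm hcap _ _) (Eventually.of_forall fun ω => ?_)
    · filter_upwards [Ioc_mem_nhdsGT (zero_lt_one' ℝ)] with ε hε
      refine Eventually.of_forall fun ω => abs_max_le_max_abs_abs.trans (max_le ?_ ?_)
      · refine (hσ ε).abs_sum_mul_waterRate_le hm hγ d (fun k => add_le_add (le_abs_self _) ?_) ω
        refine (le_abs_self _).trans ?_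
        rw [abs_mul, abs_of_pos hε.1]
        exact mul_le_of_le_one_left (abs_nonneg _) hε.2
      · exact hτ.abs_sum_mul_waterRate_le hm hγ d
          (fun k => (le_abs_self _).trans (le_add_of_nonneg_right (abs_nonneg _))) ω
    · refine tendsto_order.2 ⟨fun c hc => Eventually.of_forall fun ε =>
        hc.trans_le (le_max_right _ _), fun c hc => ?_⟩
      obtain ⟨c', hbc, hcc⟩ := exists_between hc
      have hbest : ∀ k, ω ∈ bestSet m γ lam k →
          d k * waterRate (m k) (lam k) (γ k ω) < c' := fun k hk =>
        (hτ.le_sum_mul fun j hj => hj.2 k hk).trans_lt hbc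
      filter_upwards [nhdsWithin_le_nhds (eventually_best_rate_lt lam d hbest)] with ε hε
      exact max_lt (((hσ ε).sum_mul_le fun k hk => (hε k hk).le).trans_lt hcc) hc
  refine ge_of_tendsto hlim ?_
  filter_upwards [self_mem_nhdsWithin] with ε hε
  refine (hle ε hε).trans (integral_mono ((hσ ε).integrable_sum_mul_waterRate hm hγ hγm hcap _ _)
    (((hσ ε).integrable_sum_mul_waterRate hm hγ hγm hcap _ _).sup
      (hτ.integrable_sum_mul_waterRate hm hγ hγm hcap _ _)) fun ω => le_max_left _ _)

/-- There are multipliers for which greedy time sharing meets all rate requirements exactly. -/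
theorem exists_multipliers_sharing [Nonempty ι] [IsProbabilityMeasure P] (hm : ∀ k, 0 < m k)
    (hγ : ∀ k ω, 0 < γ k ω) (hγm : ∀ k, Measurable (γ k))
    (hcap : ∀ k, Integrable (fun ω => Real.log (1 + γ k ω)) P) {R : ι → ℝ} (hR : ∀ k, 0 < R k) :
    ∃ lam : ι → ℝ, (∀ k, 0 < lam k) ∧ ∃ τ : Ω → ι → ℝ, IsSharing (bestSet m γ lam) τ ∧
      ∀ k, R k = ∫ ω, τ ω k * waterRate (m k) (lam k) (γ k ω) ∂P := by
  obtain ⟨lam, hmin⟩ := (continuous_dualLoss hm hγ hγm hcap R).exists_forall_le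
    (tendsto_dualLoss_atTop (P := P) hm hγ hγm hcap hR)
  obtain ⟨τ, hτ, he⟩ := mem_sharedRates_of_forall_direction (P := P)
    (measurableSet_bestSet m hγm lam) (exists_mem_bestSet m γ lam)
    (fun k => (measurable_waterRate (m k) (lam k)).comp (hγm k))
    (fun k ω => waterRate_nonneg _ _ _)
    (fun k => integrable_waterRate (hm k) (hγ k) (hγm k) (hcap k) _)
    (exists_sharedRates_ge_of_isMin hm hγ hγm hcap hmin)
  refine ⟨lam, fun k => ?_, τ, hτ, he⟩
  by_contra h
  have := he k
  simp only [Function.comp_apply, waterRate_of_nonpos (hm k) (not_lt.1 h) (hγ k _), mul_zero, integral_zero] at this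
  exact (hR k).ne' this

end TDMA

namespace TDMA
open Filter Topology

theorem IsGreedy.isAllocation {K : ℕ} {μ lam h ρ t : Fin K → ℝ} (hg : IsGreedy μ lam h ρ t) :
    IsAllocation ρ t where
  rate_nonneg k := by
    by_cases hk : IsBest μ lam h k
    · rw [hg.best k hk]; exact le_max_right _ _
    · rw [(hg.not_best k hk).1]
  time_nonneg := hg.time_nonneg
  time_sum := hg.time_sum

theorem isBest_iff_surplus {K : ℕ} {μ lam h : Fin K → ℝ} (hμ : ∀ k, 0 < μ k)
    (hlam : ∀ k, 0 < lam k) (hh : IsFadingState h) (i : Fin K) :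
    IsBest μ lam h i ↔
      ∀ k, surplus (μ k) (lam k) (h k) ≤ surplus (μ i) (lam i) (h i) := by
  simp only [IsBest, surplus, neg_le_neg_iff, fun k => waterRate_eq_rateMin (hμ k) (hlam k) (hh k)]

theorem solvesState_iff {K : ℕ} {μ lam h : Fin K → ℝ} (hK : 0 < K) (hμ : ∀ k, 0 < μ k)
    (hlam : ∀ k, 0 < lam k) (hh : IsFadingState h) (ρ t : Fin K → ℝ) :
    SolvesState μ lam h ρ t ↔ IsAllocation ρ t ∧
      ∀ k, 0 < t k → IsBest μ lam h k ∧ ρ k = rateMin (μ k) (lam k) (h k) := by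
  have : Nonempty (Fin K) := ⟨⟨0, hK⟩⟩
  have hp : ∀ k, waterRate (μ k) (lam k) (h k) = rateMin (μ k) (lam k) (h k) :=
    fun k => waterRate_eq_rateMin (hμ k) (hlam k) (hh k)
  have hmin : ∀ k x, 0 ≤ x → netCost (μ k) (lam k) (h k) (rateMin (μ k) (lam k) (h k)) ≤
      netCost (μ k) (lam k) (h k) x := fun k x hx => by
    rw [← hp]; exact netCost_waterRate_le (hμ k) (hh k) hx
  obtain ⟨i, hi⟩ := Finite.exists_min fun k =>
    netCost (μ k) (lam k) (h k) (rateMin (μ k) (lam k) (h k))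
  set M := netCost (μ i) (lam i) (h i) (rateMin (μ i) (lam i) (h i)) with hM
  constructor
  · refine fun hs => ⟨hs.allocation, ?_⟩
    have ha := hs.allocation
    have htest := hs.minimal (fun k => rateMin (μ k) (lam k) (h k)) (Pi.single i 1)
      ⟨fun k => le_max_right _ _, fun k => by
        by_cases hk : k = i
        · subst hk; simp
        · simp [hk], by simp⟩
    simp only [Pi.single_apply, ite_mul, one_mul, zero_mul, Finset.sum_ite_eq',
      Finset.mem_univ, if_true] at htest
    have hterm : ∀ k ∈ Finset.univ, 0 ≤ t k * (netCost (μ k) (lam k) (h k) (ρ k) - M) :=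
      fun k _ => mul_nonneg (ha.time_nonneg k)
        (sub_nonneg.2 ((hi k).trans (hmin k _ (ha.rate_nonneg k))))
    have hsum : ∑ k, t k * (netCost (μ k) (lam k) (h k) (ρ k) - M) = 0 := by
      refine le_antisymm ?_ (Finset.sum_nonneg hterm)
      simp only [mul_sub]
      rw [Finset.sum_sub_distrib, ← Finset.sum_mul, ha.time_sum, one_mul]
      exact sub_nonpos.2 htest
    intro k hk
    have h0 := (Finset.sum_eq_zero_iff_of_nonneg hterm).1 hsum k (Finset.mem_univ k)
    have hval : netCost (μ k) (lam k) (h k) (ρ k) = M :=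
      sub_eq_zero.1 ((mul_eq_zero.1 h0).resolve_left hk.ne')
    refine ⟨fun j => ((hmin k _ (ha.rate_nonneg k)).trans hval.le).trans (hi j), ?_⟩
    by_contra hne
    rw [← hp] at hne
    have h1 := netCost_waterRate_lt (hμ k) (hh k) (ha.rate_nonneg k) hne
    rw [hp, hval] at h1
    exact not_le.2 h1 (hi k)
  · rintro ⟨ha, hb⟩
    refine ⟨ha, fun ρ' t' ha' => ?_⟩
    calc ∑ k, t k * netCost (μ k) (lam k) (h k) (ρ k) ≤ ∑ k, t k * M := by
          refine Finset.sum_le_sum fun k _ => ?_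
          rcases (ha.time_nonneg k).eq_or_lt with h0 | h0
          · simp [← h0]
          · obtain ⟨h1, h2⟩ := hb k h0
            rw [h2]
            exact mul_le_mul_of_nonneg_left (h1 i) h0.le
      _ = ∑ k, t' k * M := by
          rw [← Finset.sum_mul, ← Finset.sum_mul, ha.time_sum, ha'.time_sum]
      _ ≤ _ := Finset.sum_le_sum fun k _ => mul_le_mul_of_nonneg_left
          ((hi k).trans (hmin k _ (ha'.rate_nonneg k))) (ha'.time_nonneg k)

theorem IsGreedy.solvesState {K : ℕ} {μ lam h ρ t : Fin K → ℝ} (hK : 0 < K) (hμ : ∀ k, 0 < μ k)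
    (hlam : ∀ k, 0 < lam k) (hh : IsFadingState h) (hg : IsGreedy μ lam h ρ t) :
    SolvesState μ lam h ρ t := by
  refine (solvesState_iff hK hμ hlam hh ρ t).2 ⟨hg.isAllocation, fun k hk => ?_⟩
  have hb : IsBest μ lam h k := by
    by_contra hb
    exact hk.ne' (hg.not_best k hb).2
  exact ⟨hb, hg.best k hb⟩

theorem IsGreedy.of_unique_best {K : ℕ} {μ lam h ρ t : Fin K → ℝ} (hg : IsGreedy μ lam h ρ t)
    {i : Fin K} (hi : ∀ k, IsBest μ lam h k ↔ k = i) :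
    ρ i = rateMin (μ i) (lam i) (h i) ∧ t i = 1 ∧ ∀ k, k ≠ i → ρ k = 0 ∧ t k = 0 := by
  have hne : ∀ k, k ≠ i → ρ k = 0 ∧ t k = 0 := fun k hk => hg.not_best k fun hb => hk ((hi k).1 hb)
  refine ⟨hg.best i ((hi i).2 rfl), ?_, hne⟩
  rw [← hg.time_sum]
  exact (Finset.sum_eq_single i (fun k _ hk => (hne k hk).2) (by simp)).symm

theorem power_nonneg {K : ℕ} {μ h ρ t : Fin K → ℝ} (hμ : ∀ k, 0 < μ k) (hh : IsFadingState h)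
    (ha : IsAllocation ρ t) : 0 ≤ ∑ k, μ k * (t k / h k) * ((2 : ℝ) ^ ρ k - 1) := by
  refine Finset.sum_nonneg fun k _ => mul_nonneg
    (mul_nonneg (hμ k).le (div_nonneg (ha.time_nonneg k) (hh k).le)) ?_
  exact sub_nonneg.2 (Real.one_le_rpow (by norm_num) (ha.rate_nonneg k))

theorem lintegral_power_add_rates {K : ℕ} (P : Measure (Fin K → ℝ)) (μ lam : Fin K → ℝ)
    (r τ r' τ' : (Fin K → ℝ) → Fin K → ℝ) (hr' : Measurable r') (hτ' : Measurable τ') :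
    ∫⁻ h, (ENNReal.ofReal (∑ k, μ k * (τ h k / h k) * ((2 : ℝ) ^ (r h k) - 1)) +
        ∑ k, ENNReal.ofReal (lam k) * ENNReal.ofReal (τ' h k * r' h k)) ∂P =
      avgPower P μ r τ + ∑ k, ENNReal.ofReal (lam k) * avgRate P r' τ' k := by
  have hm : ∀ k, Measurable fun h => ENNReal.ofReal (τ' h k * r' h k) := fun k =>
    (((measurable_pi_apply k).comp hτ').mul ((measurable_pi_apply k).comp hr')).ennreal_ofReal
  rw [lintegral_add_right _ (Finset.measurable_fun_sum _ fun k _ => (hm k).const_mul _),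
    lintegral_finsetSum _ fun k _ => (hm k).const_mul _]
  simp only [lintegral_const_mul _ (hm _)]
  rfl

theorem isOptimal_of_solvesState {K : ℕ} {P : Measure (Fin K → ℝ)}
    (hP : ∀ᵐ h ∂P, IsFadingState h) {Rbar μ lam : Fin K → ℝ} (hμ : ∀ k, 0 < μ k)
    (hlam : ∀ k, 0 < lam k) {r τ : (Fin K → ℝ) → Fin K → ℝ} (hpol : IsPolicy r τ)
    (hsol : ∀ h, IsFadingState h → SolvesState μ lam h (r h) (τ h))
    (hrate : ∀ k, avgRate P r τ k = ENNReal.ofReal (Rbar k)) : IsOptimal P Rbar μ r τ := by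
  refine ⟨⟨hpol, fun k => (hrate k).ge⟩, fun r' τ' hf => ?_⟩
  have hkey : avgPower P μ r τ + ∑ k, ENNReal.ofReal (lam k) * avgRate P r' τ' k ≤
      avgPower P μ r' τ' + ∑ k, ENNReal.ofReal (lam k) * avgRate P r τ k := by
    rw [← lintegral_power_add_rates P μ lam r τ r' τ' hf.policy.measurable_rate
      hf.policy.measurable_time, ← lintegral_power_add_rates P μ lam r' τ' r τ
      hpol.measurable_rate hpol.measurable_time]
    refine lintegral_mono_ae ?_
    filter_upwards [hP] with h hh
    have ha := hpol.allocation h hh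
    have ha' := hf.policy.allocation h hh
    have hterm : ∀ {ρ t : Fin K → ℝ}, IsAllocation ρ t → ∀ k ∈ Finset.univ,
        0 ≤ lam k * (t k * ρ k) := fun hal k _ =>
      mul_nonneg (hlam k).le (mul_nonneg (hal.time_nonneg k) (hal.rate_nonneg k))
    simp only [← ENNReal.ofReal_mul (hlam _).le]
    rw [← ENNReal.ofReal_sum_of_nonneg (hterm ha), ← ENNReal.ofReal_sum_of_nonneg (hterm ha'),
      ← ENNReal.ofReal_add (power_nonneg hμ hh ha) (Finset.sum_nonneg (hterm ha')),
      ← ENNReal.ofReal_add (power_nonneg hμ hh ha') (Finset.sum_nonneg (hterm ha))]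
    refine ENNReal.ofReal_le_ofReal ?_
    have e : ∀ ρ t : Fin K → ℝ, ∑ k, t k * netCost (μ k) (lam k) (h k) (ρ k) =
        ∑ k, μ k * (t k / h k) * ((2 : ℝ) ^ ρ k - 1) - ∑ k, lam k * (t k * ρ k) := by
      intro ρ t
      rw [← Finset.sum_sub_distrib]
      refine Finset.sum_congr rfl fun k _ => ?_
      rw [netCost]
      ring
    have := (hsol h hh).minimal _ _ ha'
    rw [e, e] at this
    linarith
  have hfin : ∑ k, ENNReal.ofReal (lam k) * avgRate P r τ k ≠ ⊤ :=
    ENNReal.sum_ne_top.2 fun k _ => by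
      rw [hrate]; exact ENNReal.mul_ne_top ENNReal.ofReal_ne_top ENNReal.ofReal_ne_top
  refine (ENNReal.add_le_add_iff_right hfin).1 (le_trans ?_ hkey)
  gcongr with k
  rw [hrate]
  exact hf.rate_constraint k

theorem volume_surplus_tie {K : ℕ} {μ : Fin K → ℝ} (hμ : ∀ k, 0 < μ k) (lam : Fin K → ℝ)
    {i j : Fin K} (hij : i ≠ j) :
    volume {h : Fin K → ℝ | 0 < h i ∧ 0 < surplus (μ i) (lam i) (h i) ∧
      surplus (μ i) (lam i) (h i) = surplus (μ j) (lam j) (h j)} = 0 := by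
  obtain _ | n := K
  · exact i.elim0
  set S := {h : Fin (n + 1) → ℝ | 0 < h i ∧ 0 < surplus (μ i) (lam i) (h i) ∧
      surplus (μ i) (lam i) (h i) = surplus (μ j) (lam j) (h j)} with hS
  have hm : ∀ k, Measurable fun h : Fin (n + 1) → ℝ => surplus (μ k) (lam k) (h k) :=
    fun k => (measurable_surplus _ _).comp (measurable_pi_apply k)
  have hSm : MeasurableSet S :=
    (measurableSet_lt measurable_const (measurable_pi_apply i)).inter
      ((measurableSet_lt measurable_const (hm i)).inter (measurableSet_eq_fun (hm i) (hm j)))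
  have hmp := (volume_preserving_piFinSuccAbove (fun _ : Fin (n + 1) => ℝ) i).symm
  rw [← hmp.measure_preimage hSm.nullMeasurableSet, Measure.volume_eq_prod,
    Measure.prod_apply_symm (hmp.measurable hSm)]
  rw [lintegral_eq_zero_iff' (by
    exact (measurable_measure_prodMk_right (hmp.measurable hSm)).aemeasurable)]
  refine Eventually.of_forall fun y => Set.Subsingleton.measure_zero ?_ _
  obtain ⟨j', rfl⟩ := Fin.exists_succAbove_eq hij.symm
  intro x hx x' hx'
  simp only [hS, Set.mem_preimage, Set.mem_ofPred_eq, MeasurableEquiv.piFinSuccAbove_symm_apply,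
    Fin.insertNthEquiv_apply, Fin.insertNth_apply_same, Fin.insertNth_apply_succAbove] at hx hx'
  by_contra hne
  rcases lt_or_gt_of_ne hne with hlt | hlt
  · exact (surplus_strictMono (hμ i) hx.1 hlt hx.2.1).ne (hx.2.2.trans hx'.2.2.symm)
  · exact (surplus_strictMono (hμ i) hx'.1 hlt hx'.2.1).ne (hx'.2.2.trans hx.2.2.symm)

theorem ae_isGreedy_rates_eq {K : ℕ} {P : Measure (Fin K → ℝ)}
    (hP : ∀ᵐ h ∂P, IsFadingState h) (hac : P ≪ volume) {μ lam : Fin K → ℝ} (hμ : ∀ k, 0 < μ k)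
    (hlam : ∀ k, 0 < lam k) {r τ r' τ' : (Fin K → ℝ) → Fin K → ℝ}
    (hg : ∀ h, IsFadingState h → IsGreedy μ lam h (r h) (τ h))
    (hg' : ∀ h, IsFadingState h → IsGreedy μ lam h (r' h) (τ' h)) (k : Fin K) :
    ∀ᵐ h ∂P, τ h k * r h k = τ' h k * r' h k := by
  have htie : ∀ᵐ h ∂P, ∀ j, k ≠ j → ¬ (0 < h k ∧ 0 < surplus (μ k) (lam k) (h k) ∧
      surplus (μ k) (lam k) (h k) = surplus (μ j) (lam j) (h j)) := by
    refine ae_all_iff.2 fun j => ?_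
    by_cases hkj : k = j
    · exact Eventually.of_forall fun h hne => absurd hkj hne
    · have := hac (volume_surplus_tie hμ lam hkj)
      filter_upwards [measure_eq_zero_iff_ae_notMem.1 this] with h hh _ using hh
  filter_upwards [hP, htie] with h hh ht
  by_cases hk : IsBest μ lam h k
  · have hr := (hg h hh).best k hk
    have hr' := (hg' h hh).best k hk
    rw [← waterRate_eq_rateMin (hμ k) (hlam k) (hh k)] at hr hr'
    rcases (waterRate_nonneg (μ k) (lam k) (h k)).eq_or_lt with h0 | h0
    · rw [hr, hr', ← h0, mul_zero, mul_zero]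
    · have hpos := surplus_pos (hμ k) (hh k) h0
      have huniq : ∀ j, IsBest μ lam h j ↔ j = k := fun j => by
        refine ⟨fun hj => ?_, fun e => e ▸ hk⟩
        by_contra hne
        rw [isBest_iff_surplus hμ hlam hh] at hj hk
        exact ht j (Ne.symm hne) ⟨hh k, hpos, le_antisymm (hj k) (hk j)⟩
      rw [hr, hr', ((hg h hh).of_unique_best huniq).2.1, ((hg' h hh).of_unique_best huniq).2.1]
  · rw [((hg h hh).not_best k hk).2, ((hg' h hh).not_best k hk).2, zero_mul, zero_mul]

/-- The channel gains, changed to one where they are not positive. -/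
noncomputable def gain {K : ℕ} (k : Fin K) (h : Fin K → ℝ) : ℝ := if 0 < h k then h k else 1

theorem gain_pos {K : ℕ} (k : Fin K) (h : Fin K → ℝ) : 0 < gain k h := by
  rw [gain]; split_ifs with hk
  · exact hk
  · exact one_pos

theorem gain_eq {K : ℕ} {h : Fin K → ℝ} (hh : IsFadingState h) (k : Fin K) : gain k h = h k :=
  if_pos (hh k)

theorem measurable_gain {K : ℕ} (k : Fin K) : Measurable (gain k) :=
  Measurable.ite (measurableSet_lt measurable_const (measurable_pi_apply k))
    (measurable_pi_apply k) measurable_const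

theorem exists_greedy_policy {K : ℕ} (hK : 0 < K) {P : Measure (Fin K → ℝ)}
    [IsProbabilityMeasure P] (hP : ∀ᵐ h ∂P, IsFadingState h)
    (hcap : ∀ k, Integrable (fun h : Fin K → ℝ => Real.log (1 + h k)) P) {Rbar : Fin K → ℝ}
    (hR : ∀ k, 0 < Rbar k) {μ : Fin K → ℝ} (hμ : ∀ k, 0 < μ k) :
    ∃ lam : Fin K → ℝ, (∀ k, 0 < lam k) ∧ ∃ r τ : (Fin K → ℝ) → Fin K → ℝ,
      Measurable r ∧ Measurable τ ∧
      (∀ h, IsFadingState h → IsGreedy μ lam h (r h) (τ h)) ∧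
      ∀ k, avgRate P r τ k = ENNReal.ofReal (Rbar k) := by
  classical
  have : Nonempty (Fin K) := ⟨⟨0, hK⟩⟩
  have hcap' : ∀ k, Integrable (fun h : Fin K → ℝ => Real.log (1 + gain k h)) P := fun k => by
    refine (hcap k).congr ?_
    filter_upwards [hP] with h hh
    rw [gain_eq hh]
  obtain ⟨lam, hlam, τ, hτ, hrate⟩ := exists_multipliers_sharing (P := P) (γ := gain) hμ gain_pos
    measurable_gain hcap' hR
  have hbest : ∀ h, IsFadingState h → ∀ k, h ∈ bestSet μ gain lam k ↔ IsBest μ lam h k := by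
    intro h hh k
    rw [isBest_iff_surplus hμ hlam hh]
    simp only [bestSet, Set.mem_ofPred_eq, gain_eq hh]
  set r : (Fin K → ℝ) → Fin K → ℝ := fun h k =>
    if h ∈ bestSet μ gain lam k then waterRate (μ k) (lam k) (gain k h) else 0 with hr
  refine ⟨lam, hlam, r, τ, measurable_pi_lambda _ fun k => ?_, hτ.measurable, fun h hh => ?_,
    fun k => ?_⟩
  · exact Measurable.ite (measurableSet_bestSet μ measurable_gain lam k)
      ((measurable_waterRate _ _).comp (measurable_gain k)) measurable_const
  · refine ⟨hτ.nonneg h, hτ.sum_eq_one h, fun k hk => ?_, fun k hk => ?_⟩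
    · rw [hr]
      dsimp only
      rw [if_pos ((hbest h hh k).2 hk), gain_eq hh, waterRate_eq_rateMin (hμ k) (hlam k) (hh k)]
    · have hk' := fun h' => hk ((hbest h hh k).1 h')
      exact ⟨if_neg hk', hτ.eq_zero h k hk'⟩
  · have e : ∀ h, τ h k * r h k = τ h k * waterRate (μ k) (lam k) (gain k h) := fun h => by
      by_cases hb : h ∈ bestSet μ gain lam k
      · rw [hr]; dsimp only; rw [if_pos hb]
      · rw [hτ.eq_zero h k hb, zero_mul, zero_mul]
    simp only [avgRate, e]
    rw [hrate, ofReal_integral_eq_lintegral_ofReal (hτ.integrable_mul k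
      (integrable_waterRate (hμ k) (gain_pos k) (measurable_gain k) (hcap' k) _))
      (Eventually.of_forall fun h => mul_nonneg (hτ.nonneg h k) (waterRate_nonneg _ _ _))]

end TDMA

theorem theorem4 (K : ℕ) (hK : 0 < K)
    -- the law of the fading state: positive gains, finite ergodic capacities
    (P : Measure (Fin K → ℝ)) [IsProbabilityMeasure P]
    (hP : ∀ᵐ h ∂P, TDMA.IsFadingState h)
    (hcap : ∀ k, Integrable (fun h : Fin K → ℝ => Real.log (1 + h k)) P)
    (Rbar : Fin K → ℝ) (hR : ∀ k, 0 < Rbar k)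
    (μ : Fin K → ℝ) (hμ : ∀ k, 0 < μ k) :
    ∃ lam : Fin K → ℝ, (∀ k, 0 < lam k) ∧
      -- each `f_k` is convex and is minimized over nonnegative rates at `r_{k,min}`
      (∀ h, TDMA.IsFadingState h → ∀ k,
        ConvexOn ℝ Set.univ (TDMA.netCost (μ k) (lam k) (h k)) ∧
        0 ≤ TDMA.rateMin (μ k) (lam k) (h k) ∧
        IsMinOn (TDMA.netCost (μ k) (lam k) (h k)) (Set.Ici 0)
          (TDMA.rateMin (μ k) (lam k) (h k))) ∧
      -- the solutions of the problem of one state: only best users transmit, at rate `r_{k,min}`,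
      -- and an arbitrary time division among them is allowed
      (∀ h, TDMA.IsFadingState h → ∀ ρ t : Fin K → ℝ,
        TDMA.SolvesState μ lam h ρ t ↔
          TDMA.IsAllocation ρ t ∧
            ∀ k, 0 < t k → TDMA.IsBest μ lam h k ∧ ρ k = TDMA.rateMin (μ k) (lam k) (h k)) ∧
      -- optimal policies that solve the problem of each state, by greedy water-filling, and meet
      -- the rate constraints with equality
      (∃ r τ : (Fin K → ℝ) → Fin K → ℝ,
        TDMA.IsOptimal P Rbar μ r τ ∧
        (∀ h, TDMA.IsFadingState h → TDMA.SolvesState μ lam h (r h) (τ h)) ∧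
        (∀ h, TDMA.IsFadingState h → TDMA.IsGreedy μ lam h (r h) (τ h)) ∧
        (∀ h, TDMA.IsFadingState h → ∀ i, (∀ k, TDMA.IsBest μ lam h k ↔ k = i) →
          r h i = TDMA.rateMin (μ i) (lam i) (h i) ∧ τ h i = 1 ∧
            ∀ k, k ≠ i → r h k = 0 ∧ τ h k = 0) ∧
        (∀ k, TDMA.avgRate P r τ k = ENNReal.ofReal (Rbar k))) ∧
      -- if the fading law has a density, the time division among best users is arbitrary
      (P ≪ volume → ∀ r τ : (Fin K → ℝ) → Fin K → ℝ, Measurable r → Measurable τ →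
        (∀ h, TDMA.IsFadingState h → TDMA.IsGreedy μ lam h (r h) (τ h)) →
          TDMA.IsOptimal P Rbar μ r τ ∧
          ∀ k, TDMA.avgRate P r τ k = ENNReal.ofReal (Rbar k)) := by
  obtain ⟨lam, hlam, r, τ, hr, hτ, hg, hrate⟩ :=
    TDMA.exists_greedy_policy hK hP hcap hR hμ
  have hopt : ∀ r τ : (Fin K → ℝ) → Fin K → ℝ, Measurable r → Measurable τ →
      (∀ h, TDMA.IsFadingState h → TDMA.IsGreedy μ lam h (r h) (τ h)) →
      (∀ k, TDMA.avgRate P r τ k = ENNReal.ofReal (Rbar k)) → TDMA.IsOptimal P Rbar μ r τ :=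
    fun r τ hr hτ hg hrate => TDMA.isOptimal_of_solvesState hP hμ hlam
      ⟨hr, hτ, fun h hh => (hg h hh).isAllocation⟩
      (fun h hh => (hg h hh).solvesState hK hμ hlam hh) hrate
  refine ⟨lam, hlam, fun h hh k => ⟨TDMA.convexOn_netCost (hμ k) (hh k), le_max_right _ _,
    fun x hx => ?_⟩, fun h hh ρ t => TDMA.solvesState_iff hK hμ hlam hh ρ t,
    ⟨r, τ, hopt r τ hr hτ hg hrate, fun h hh => (hg h hh).solvesState hK hμ hlam hh, hg,
      fun h hh i hi => (hg h hh).of_unique_best hi, hrate⟩, fun hac r' τ' hr' hτ' hg' => ?_⟩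
  · rw [← TDMA.waterRate_eq_rateMin (hμ k) (hlam k) (hh k)]
    exact TDMA.netCost_waterRate_le (hμ k) (hh k) hx
  · have hrate' : ∀ k, TDMA.avgRate P r' τ' k = ENNReal.ofReal (Rbar k) := fun k => by
      rw [← hrate k]
      refine lintegral_congr_ae ?_
      filter_upwards [TDMA.ae_isGreedy_rates_eq hP hac hμ hlam hg' hg k] with h e
      rw [e]
    exact ⟨hopt r' τ' hr' hτ' hg' hrate', hrate'⟩
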